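/- A Euclidean lattice $\overline{E} = (E, \|\cdot\|)$ is a free $\mathbb{Z}$-module $E$ of finite rank (possibly zero) together with a Euclidean norm $\|\cdot\|$ on the real vector space $E_{\mathbb{R}} := E \otimes \mathbb{R}$; equivalently, it is a lattice $E$ (a discrete subgroup spanning the space over $\mathbb{R}$) in a finite-dimensional Euclidean vector space $E_{\mathbb{R}}$. Put $$h^0_\theta(\overline{E}) := \log \sum_{v \in E} e^{-\pi \|v\|^2}.$$ 1) For any two Euclidean lattices $\overline{E}_1 = (E_1, \|\cdot\|_1)$ and $\overline{E}_2 = (E_2, \|\cdot\|_2)$, let $\overline{E}_1 \oplus \overline{E}_2$ be the module $E_1 \oplus E_2$ with the Euclidean norm on $E_{1,\mathbb{R}} \oplus E_{2,\mathbb{R}}$ given by $\|x_1 \oplus x_2\|^2 = \|x_1\|_1^2 + \|x_2\|_2^2$. Then $$h^0_\theta(\overline{E}_1 \oplus \overline{E}_2) = h^0_\theta(\overline{E}_1) + h^0_\theta(\overline{E}_2).$$ 2) Let $\overline{E} = (E, \|\cdot\|)$ be a Euclidean lattice and let $F$ be a saturated $\mathbb{Z}$-submodule of $E$, that is, one for which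 $E/F$ is torsion-free. Let $\overline{F}$ be $F$ with the restriction of $\|\cdot\|$ to $F_{\mathbb{R}} \subseteq E_{\mathbb{R}}$, and let $\overline{E/F}$ be $E/F$ with the quotient norm on $(E/F)_{\mathbb{R}} = E_{\mathbb{R}}/F_{\mathbb{R}}$, so that $0 \to \overline{F} \to \overline{E} \to \overline{E/F} \to 0$ is an admissible short exact sequence of Euclidean lattices. Then $$h^0_\theta(\overline{E}) \leq h^0_\theta(\overline{F}) + h^0_\theta(\overline{E/F}).$$ -/

import Mathlib

universe u v

/-- A Euclidean lattice: a finite-dimensional real vector space with a Euclidean norm, together with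
a lattice in it (a discrete subgroup that spans the space over `ℝ`). The rank may be zero. -/
structure EuclideanLattice where
  /-- The real vector space `E_ℝ`. -/
  space : Type u
  [normedAddCommGroup : NormedAddCommGroup space]
  [innerProductSpace : InnerProductSpace ℝ space]
  [finiteDimensional : FiniteDimensional ℝ space]
  /-- The free `ℤ`-module `E`, sitting inside `E_ℝ`. -/
  lattice : Submodule ℤ space
  [discreteTopology : DiscreteTopology lattice]
  [isZLattice : IsZLattice ℝ lattice]

namespace EuclideanLattice

attribute [instance] normedAddCommGroup innerProductSpace finiteDimensional discreteTopology
  isZLattice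

/-- The theta series `θ_E(t) = ∑_{v ∈ E} exp (-π t ‖v‖²)`. -/
noncomputable def theta (E : EuclideanLattice.{u}) (t : ℝ) : ℝ :=
  ∑' v : E.lattice, Real.exp (-Real.pi * t * ‖(v : E.space)‖ ^ 2)

/-- The theta series converges for `t > 0`, so that the value of `tsum` is its sum. -/
theorem summable_theta (E : EuclideanLattice.{u}) {t : ℝ} (ht : 0 < t) :
    Summable fun v : E.lattice => Real.exp (-Real.pi * t * ‖(v : E.space)‖ ^ 2) := by
  set d : ℕ := Module.finrank ℤ E.lattice + 1 with hd
  have hc : 0 < Real.pi * t := mul_pos Real.pi_pos ht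
  have hs : Summable fun v : E.lattice =>
      (d.factorial / (Real.pi * t) ^ d : ℝ) * (‖v‖⁻¹ ^ (2 * d)) :=
    (ZLattice.summable_norm_pow_inv E.lattice (2 * d) (by omega)).mul_left _
  refine hs.of_norm_bounded_eventually ?_
  have h0 : ∀ᶠ v : E.lattice in Filter.cofinite, v ≠ 0 := by
    simp [Filter.eventually_cofinite]
  filter_upwards [h0] with v hv
  have hv' : 0 < ‖v‖ := norm_pos_iff.mpr hv
  rw [Real.norm_of_nonneg (Real.exp_nonneg _)]
  have hx : 0 < Real.pi * t * ‖v‖ ^ 2 := by positivity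
  have key := Real.pow_div_factorial_le_exp _ hx.le d
  have e1 : -Real.pi * t * ‖(v : E.space)‖ ^ 2 = -(Real.pi * t * ‖v‖ ^ 2) := by
    rw [Submodule.coe_norm]; ring
  rw [e1, Real.exp_neg]
  calc (Real.exp (Real.pi * t * ‖v‖ ^ 2))⁻¹
      ≤ ((Real.pi * t * ‖v‖ ^ 2) ^ d / d.factorial)⁻¹ := inv_anti₀ (by positivity) key
    _ = _ := by
      rw [mul_pow, ← pow_mul, inv_pow]
      field_simp

/-- The invariant `h⁰_θ(E) = log θ_E(1) = log ∑_{v ∈ E} exp (-π ‖v‖²)`. -/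
noncomputable def h0theta (E : EuclideanLattice.{u}) : ℝ :=
  Real.log (E.theta 1)

section DirectSum

variable (E₁ : EuclideanLattice.{u}) (E₂ : EuclideanLattice.{v})

/-- The `ℤ`-module `E₁ ⊕ E₂` inside the orthogonal direct sum of `E₁_ℝ` and `E₂_ℝ`. -/
def directSumLattice : Submodule ℤ (WithLp 2 (E₁.space × E₂.space)) where
  carrier := {x | x.fst ∈ E₁.lattice ∧ x.snd ∈ E₂.lattice}
  add_mem' hx hy := ⟨E₁.lattice.add_mem hx.1 hy.1, E₂.lattice.add_mem hx.2 hy.2⟩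
  zero_mem' := ⟨E₁.lattice.zero_mem, E₂.lattice.zero_mem⟩
  smul_mem' n _ hx := ⟨E₁.lattice.smul_mem n hx.1, E₂.lattice.smul_mem n hx.2⟩

instance : DiscreteTopology (E₁.directSumLattice E₂) := by
  let f : E₁.directSumLattice E₂ → E₁.lattice × E₂.lattice :=
    fun x => (⟨x.1.fst, x.2.1⟩, ⟨x.1.snd, x.2.2⟩)
  have hf : Continuous f := by
    refine Continuous.prodMk ?_ ?_
    · exact ((WithLp.continuous_fst 2 _ _).comp continuous_subtype_val).subtype_mk _
    · exact ((WithLp.continuous_snd 2 _ _).comp continuous_subtype_val).subtype_mk _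
  refine DiscreteTopology.of_continuous_injective hf ?_
  rintro ⟨x, hx⟩ ⟨y, hy⟩ h
  simp only [f, Prod.mk.injEq, Subtype.mk.injEq] at h
  exact Subtype.ext (WithLp.ofLp_injective 2 (Prod.ext h.1 h.2))

instance : IsZLattice ℝ (E₁.directSumLattice E₂) where
  span_top := by
    have h1 : ∀ x : E₁.space, WithLp.toLp 2 (x, (0 : E₂.space)) ∈
        Submodule.span ℝ (E₁.directSumLattice E₂ : Set (WithLp 2 (E₁.space × E₂.space))) := by
      intro x
      have hx : x ∈ Submodule.span ℝ (E₁.lattice : Set E₁.space) := by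
        rw [IsZLattice.span_top]; trivial
      induction hx using Submodule.span_induction with
      | mem x hx => exact Submodule.subset_span ⟨hx, E₂.lattice.zero_mem⟩
      | zero => exact Submodule.zero_mem _
      | add x y _ _ hx hy =>
        have := Submodule.add_mem _ hx hy
        rwa [← WithLp.toLp_add, Prod.mk_add_mk, add_zero] at this
      | smul a x _ hx =>
        have := Submodule.smul_mem _ a hx
        rwa [← WithLp.toLp_smul, Prod.smul_mk, smul_zero] at this
    have h2 : ∀ x : E₂.space, WithLp.toLp 2 ((0 : E₁.space), x) ∈
        Submodule.span ℝ (E₁.directSumLattice E₂ : Set (WithLp 2 (E₁.space × E₂.space))) := by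
      intro x
      have hx : x ∈ Submodule.span ℝ (E₂.lattice : Set E₂.space) := by
        rw [IsZLattice.span_top]; trivial
      induction hx using Submodule.span_induction with
      | mem x hx => exact Submodule.subset_span ⟨E₁.lattice.zero_mem, hx⟩
      | zero => exact Submodule.zero_mem _
      | add x y _ _ hx hy =>
        have := Submodule.add_mem _ hx hy
        rwa [← WithLp.toLp_add, Prod.mk_add_mk, add_zero] at this
      | smul a x _ hx =>
        have := Submodule.smul_mem _ a hx
        rwa [← WithLp.toLp_smul, Prod.smul_mk, smul_zero] at this
    rw [eq_top_iff]
    intro x _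
    have := Submodule.add_mem _ (h1 x.fst) (h2 x.snd)
    rwa [← WithLp.toLp_add, Prod.mk_add_mk, add_zero, zero_add] at this

/-- The direct sum `E₁ ⊕ E₂` of Euclidean lattices, with `‖x₁ ⊕ x₂‖² = ‖x₁‖² + ‖x₂‖²`. -/
noncomputable def directSum : EuclideanLattice.{max u v} where
  space := WithLp 2 (E₁.space × E₂.space)
  lattice := E₁.directSumLattice E₂

end DirectSum

section Sub

variable (E : EuclideanLattice.{u}) (F : Submodule ℤ E.lattice)

/-- The real span `F_ℝ` in `E_ℝ` of a submodule `F` of `E`. -/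
def realSpan : Submodule ℝ E.space :=
  Submodule.span ℝ (F.map E.lattice.subtype : Set E.space)

instance : IsClosed (E.realSpan F : Set E.space) := Submodule.closed_of_finiteDimensional _

/-- The submodule `F` of `E`, seen inside `F_ℝ`. -/
def subLattice : Submodule ℤ (E.realSpan F) :=
  (F.map E.lattice.subtype).comap ((E.realSpan F).subtype.restrictScalars ℤ)

instance : DiscreteTopology (E.subLattice F) := by
  have hmem : ∀ x : E.subLattice F, (x.1 : E.space) ∈ E.lattice := by
    rintro ⟨x, y, _, hy⟩
    have : (x : E.space) = y := hy.symm
    rw [this]; exact y.2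
  let f : E.subLattice F → E.lattice := fun x => ⟨x.1, hmem x⟩
  have hf : Continuous f :=
    (continuous_subtype_val.comp continuous_subtype_val).subtype_mk _
  refine DiscreteTopology.of_continuous_injective hf ?_
  intro x y h
  exact Subtype.ext (Subtype.ext (congrArg (fun z : E.lattice => (z : E.space)) h))

instance : IsZLattice ℝ (E.subLattice F) where
  span_top := Submodule.span_span_coe_preimage

/-- The Euclidean lattice `(F, ‖·‖|F_ℝ)` attached to a submodule `F` of `E`. -/
noncomputable def sub : EuclideanLattice.{u} where
  space := E.realSpan F
  lattice := E.subLattice F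

/-- `F` is saturated in `E`: the `ℤ`-module `E / F` is torsion-free. -/
def IsSaturated : Prop := Module.IsTorsionFree ℤ (E.lattice ⧸ F)

/-- The canonical map `E / F → E_ℝ / F_ℝ`. -/
noncomputable def quotientMap : (E.lattice ⧸ F) →ₗ[ℤ] (E.space ⧸ E.realSpan F) :=
  F.liftQ (((E.realSpan F).mkQ.restrictScalars ℤ).comp E.lattice.subtype) (by
    intro x hx
    simp only [LinearMap.mem_ker, LinearMap.comp_apply, LinearMap.restrictScalars_apply,
      Submodule.mkQ_apply, Submodule.Quotient.mk_eq_zero]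
    exact Submodule.subset_span (Submodule.mem_map_of_mem (f := E.lattice.subtype) hx))

variable {F}

theorem exists_basis_quotientMap (hF : E.IsSaturated F) :
    ∃ (ι : Type u) (_ : Fintype ι) (b : Module.Basis ι ℤ (E.lattice ⧸ F))
      (c : Module.Basis ι ℝ (E.space ⧸ E.realSpan F)), ∀ i, c i = E.quotientMap F (b i) := by
  have : Module.IsTorsionFree ℤ (E.lattice ⧸ F) := hF
  let b := Module.Free.chooseBasis ℤ (E.lattice ⧸ F)
  have hmk : ∀ x : E.lattice, E.quotientMap F (Submodule.Quotient.mk x) =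
      (E.realSpan F).mkQ (x : E.space) := fun x => rfl
  have hspan : ⊤ ≤ Submodule.span ℝ (Set.range fun i => E.quotientMap F (b i)) := by
    have hq : ∀ y : E.lattice ⧸ F, E.quotientMap F y ∈
        Submodule.span ℝ (Set.range fun i => E.quotientMap F (b i)) := by
      intro y
      rw [← b.sum_repr y, map_sum]
      refine Submodule.sum_mem _ fun i _ => ?_
      rw [map_zsmul]
      have hi : E.quotientMap F (b i) ∈ Submodule.span ℝ (Set.range fun i => E.quotientMap F (b i)) :=
        Submodule.subset_span (Set.mem_range_self i)
      exact zsmul_mem hi _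
    intro z _
    obtain ⟨x, rfl⟩ := Submodule.mkQ_surjective _ z
    have hx : x ∈ Submodule.span ℝ (E.lattice : Set E.space) := by
      rw [IsZLattice.span_top]; trivial
    induction hx using Submodule.span_induction with
    | mem x hx => exact (hmk ⟨x, hx⟩) ▸ hq _
    | zero => rw [map_zero]; exact Submodule.zero_mem _
    | add x y _ _ hx hy => rw [map_add]; exact Submodule.add_mem _ (hx trivial) (hy trivial)
    | smul a x _ hx => rw [map_smul]; exact Submodule.smul_mem _ _ (hx trivial)
  have hF1 : Module.finrank ℤ F = Module.finrank ℝ (E.realSpan F) := by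
    rw [← ZLattice.rank ℝ (E.subLattice F)]
    have hle : F.map E.lattice.subtype ≤ (E.realSpan F).restrictScalars ℤ :=
      Submodule.subset_span
    have e1 := (Submodule.equivMapOfInjective E.lattice.subtype
      E.lattice.injective_subtype F).finrank_eq
    have e2 := (Submodule.comapSubtypeEquivOfLe hle).finrank_eq
    exact e1.trans e2.symm
  have hcard : Fintype.card (Module.Free.ChooseBasisIndex ℤ (E.lattice ⧸ F)) =
      Module.finrank ℝ (E.space ⧸ E.realSpan F) := by
    rw [← Module.finrank_eq_card_basis b]
    have h1 := Submodule.finrank_quotient_add_finrank F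
    have h2 := Submodule.finrank_quotient_add_finrank (E.realSpan F)
    have h3 := ZLattice.rank ℝ E.lattice
    omega
  exact ⟨_, inferInstance, b, basisOfTopLeSpanOfCardEqFinrank _ hspan hcard, fun i => by simp⟩

/-- For saturated `F`, the canonical map identifies `E / F` with its image in `E_ℝ / F_ℝ`. -/
theorem quotientMap_injective (hF : E.IsSaturated F) :
    Function.Injective (E.quotientMap F) := by
  obtain ⟨ι, _, b, c, hc⟩ := E.exists_basis_quotientMap hF
  rw [← LinearMap.ker_eq_bot, LinearMap.ker_eq_bot']
  intro y hy
  have hli : LinearIndependent ℤ c := c.linearIndependent.restrict_scalars' ℤ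
  rw [← b.sum_repr y, map_sum] at hy
  simp only [map_zsmul, ← hc] at hy
  have := Fintype.linearIndependent_iff.mp hli _ hy
  rw [← b.sum_repr y]
  simp [this]

theorem range_quotientMap_eq_span (hF : E.IsSaturated F) :
    ∃ (ι : Type u) (_ : Fintype ι) (c : Module.Basis ι ℝ (E.space ⧸ E.realSpan F)),
      LinearMap.range (E.quotientMap F) = Submodule.span ℤ (Set.range c) := by
  obtain ⟨ι, hι, b, c, hc⟩ := E.exists_basis_quotientMap hF
  refine ⟨ι, hι, c, ?_⟩
  rw [← Submodule.map_top, ← b.span_eq, Submodule.map_span, ← Set.range_comp]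
  congr 2
  exact funext fun i => (hc i).symm

theorem discreteTopology_range_quotientMap (hF : E.IsSaturated F) :
    DiscreteTopology (LinearMap.range (E.quotientMap F)) := by
  obtain ⟨ι, _, c, hc⟩ := E.range_quotientMap_eq_span hF
  rw [hc]
  infer_instance

theorem span_range_quotientMap (hF : E.IsSaturated F) :
    Submodule.span ℝ (LinearMap.range (E.quotientMap F) : Set (E.space ⧸ E.realSpan F)) = ⊤ := by
  obtain ⟨ι, _, c, hc⟩ := E.range_quotientMap_eq_span hF
  rw [hc]
  exact ZSpan.span_top c

/-- The Euclidean lattice `(E / F, ‖·‖_quot)` attached to a saturated submodule `F` of `E`: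
the module `E / F` inside `E_ℝ / F_ℝ` with the quotient Euclidean norm. -/
noncomputable def quotient (F : Submodule ℤ E.lattice) (hF : E.IsSaturated F) :
    EuclideanLattice.{u} :=
  have hd : DiscreteTopology (LinearMap.range (E.quotientMap F)) :=
    E.discreteTopology_range_quotientMap hF
  { space := E.space ⧸ E.realSpan F
    lattice := LinearMap.range (E.quotientMap F)
    discreteTopology := hd
    isZLattice := ⟨E.span_range_quotientMap hF⟩ }

end Sub

end EuclideanLattice

open scoped ENNReal

namespace EuclideanLattice

/-! Additivity holds because the theta series of an orthogonal sum is a product. For subadditivity,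
the theta series of `E` is split over the cosets of `F`. By Pythagoras, a coset contributes a
Gaussian factor from its component orthogonal to `F_ℝ`, times the Gaussian mass of a translate of
`F`. Everything thus rests on `gaussianMass_le`: the mass of a translate is largest at the origin.

That maximum principle is obtained without Poisson summation. The parallelogram law and AM-GM give
`2 g(x)² ≤ g(2x) g(0) + g(0)²` for the mass `g`. As `g` is bounded, its supremum `M` satisfies `2M²
≤ M g(0) + g(0)²`, that is `(2M + g(0))(M - g(0)) ≤ 0`, so `M ≤ g(0)`. Masses take values in `ℝ≥0∞`
so that sums can be rearranged freely. -/

/-- The Gaussian mass `∑_{f ∈ E} exp (-π ‖f + x‖²)` of the translate `E + x`. -/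
noncomputable def gaussianMass (E : EuclideanLattice.{u}) (x : E.space) : ℝ≥0∞ :=
  ∑' f : E.lattice, ENNReal.ofReal (Real.exp (-Real.pi * ‖(f : E.space) + x‖ ^ 2))

theorem gaussianMass_zero (E : EuclideanLattice.{u}) :
    E.gaussianMass 0 = ENNReal.ofReal (E.theta 1) := by
  rw [theta, ENNReal.ofReal_tsum_of_nonneg (fun _ => (Real.exp_pos _).le)
    (E.summable_theta one_pos)]
  simp [gaussianMass]

theorem theta_pos (E : EuclideanLattice.{u}) {t : ℝ} (ht : 0 < t) : 0 < E.theta t :=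
  (E.summable_theta ht).tsum_pos (fun _ => (Real.exp_pos _).le) 0 (Real.exp_pos _)

theorem gaussianMass_add_lattice (E : EuclideanLattice.{u}) (l : E.lattice) (x : E.space) :
    E.gaussianMass (l + x) = E.gaussianMass x := by
  rw [gaussianMass, gaussianMass, ← (Equiv.addRight l).tsum_eq fun f : E.lattice =>
    ENNReal.ofReal (Real.exp (-Real.pi * ‖(f : E.space) + x‖ ^ 2))]
  simp [add_assoc]

/-! ### Boundedness of the Gaussian mass -/

theorem exp_neg_pi_norm_add_sq_le {V : Type*} [NormedAddCommGroup V] [InnerProductSpace ℝ V]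
    (f x : V) {R : ℝ} (hx : ‖x‖ ≤ R) :
    Real.exp (-Real.pi * ‖f + x‖ ^ 2) ≤
      Real.exp (Real.pi * R ^ 2) * Real.exp (-Real.pi * (1 / 2) * ‖f‖ ^ 2) := by
  rw [← Real.exp_add, Real.exp_le_exp]
  have h := parallelogram_law_with_norm ℝ (f + x) x
  rw [add_sub_cancel_right] at h
  have h2 : ‖x‖ ^ 2 ≤ R ^ 2 := pow_le_pow_left₀ (norm_nonneg x) hx 2
  have h3 : (1 / 2) * ‖f‖ ^ 2 ≤ ‖f + x‖ ^ 2 + R ^ 2 := by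
    nlinarith [sq_nonneg ‖f + x + x‖]
  nlinarith [mul_le_mul_of_nonneg_left h3 Real.pi_pos.le]

/-- The mass is periodic under the lattice, so `x` may be moved into a bounded fundamental domain,
where the preceding estimate dominates the series uniformly. This makes the supremum in
`gaussianMass_le` finite. -/
theorem exists_gaussianMass_le (E : EuclideanLattice.{u}) :
    ∃ C : ℝ, ∀ x, E.gaussianMass x ≤ ENNReal.ofReal C := by
  let b := (Module.Free.chooseBasis ℤ E.lattice).ofZLatticeBasis ℝ E.lattice
  have hb : Submodule.span ℤ (Set.range b) = E.lattice :=
    (Module.Free.chooseBasis ℤ E.lattice).ofZLatticeBasis_span ℝ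
  set R : ℝ := ∑ i, ‖b i‖
  refine ⟨Real.exp (Real.pi * R ^ 2) * E.theta (1 / 2), fun x => ?_⟩
  have hx : x = (ZSpan.floor b x : E.space) + ZSpan.fract b x := by
    rw [ZSpan.fract_apply, add_sub_cancel]
  have hl : (ZSpan.floor b x : E.space) ∈ E.lattice := hb.le (ZSpan.floor b x).2
  rw [hx, E.gaussianMass_add_lattice ⟨_, hl⟩, theta, ← tsum_mul_left,
    ENNReal.ofReal_tsum_of_nonneg (fun _ => by positivity)
      ((E.summable_theta one_half_pos).mul_left _)]
  exact ENNReal.tsum_le_tsum fun f => ENNReal.ofReal_le_ofReal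
    (exp_neg_pi_norm_add_sq_le _ _ (ZSpan.norm_fract_le b x))

/-! ### The duplication inequality and the maximum at the origin -/

/-- The contribution `∑_{a ∈ c} exp (-π/2 ‖a + z‖²)` of a class `c` of `E` modulo `2E`. -/
noncomputable def classMass (E : EuclideanLattice.{u})
    (c : E.lattice ⧸ LinearMap.range (LinearMap.lsmul ℤ E.lattice 2)) (z : E.space) : ℝ≥0∞ :=
  ∑' a : {a : E.lattice // Submodule.Quotient.mk a = c},
    ENNReal.ofReal (Real.exp (-Real.pi / 2 * ‖(a : E.space) + z‖ ^ 2))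

/-- The map `(f, g) ↦ (f + g, f - g)` from pairs of lattice vectors onto pairs congruent
modulo `2`. -/
noncomputable def addSubEquiv (E : EuclideanLattice.{u}) : E.lattice × E.lattice ≃
    Σ c : E.lattice ⧸ LinearMap.range (LinearMap.lsmul ℤ E.lattice 2),
      {a : E.lattice // Submodule.Quotient.mk a = c} ×
        {a : E.lattice // Submodule.Quotient.mk a = c} :=
  Equiv.ofBijective
    (fun p => ⟨Submodule.Quotient.mk (p.1 + p.2), ⟨p.1 + p.2, rfl⟩, ⟨p.1 - p.2, by
      rw [Submodule.Quotient.eq]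
      exact ⟨-p.2, by simp only [LinearMap.lsmul_apply]; module⟩⟩⟩) (by
    constructor
    · intro p q h
      have h1 : p.1 + p.2 = q.1 + q.2 := congrArg (fun s => s.2.1.1) h
      have h2 : p.1 - p.2 = q.1 - q.2 := congrArg (fun s => s.2.2.1) h
      have h3 : (2 : ℤ) • p.1 = (2 : ℤ) • q.1 := by
        calc (2 : ℤ) • p.1 = (p.1 + p.2) + (p.1 - p.2) := by module
          _ = (q.1 + q.2) + (q.1 - q.2) := by rw [h1, h2]
          _ = (2 : ℤ) • q.1 := by module
      have h4 : p.1 = q.1 := smul_right_injective _ (two_ne_zero (α := ℤ)) h3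
      rw [h4] at h1
      exact Prod.ext h4 (add_left_cancel h1)
    · rintro ⟨c, ⟨a, ha⟩, ⟨b, hb⟩⟩
      obtain ⟨d, hd⟩ := (Submodule.Quotient.eq _).mp (hb.trans ha.symm)
      simp only [LinearMap.lsmul_apply] at hd
      obtain ⟨f, g, rfl, rfl⟩ : ∃ f g, f + g = a ∧ f - g = b := by
        -- Since `2d = b - a`, these are the half-sum and half-difference of `a` and `b`.
        refine ⟨a + d, -d, by abel, ?_⟩
        rw [sub_neg_eq_add, add_assoc, ← two_zsmul, hd, add_sub_cancel]
      subst ha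
      exact ⟨(f, g), rfl⟩)

theorem tsum_mul_tsum_eq_tsum_prod {α β : Type*} (u : α → ℝ≥0∞) (w : β → ℝ≥0∞) :
    (∑' a, u a) * ∑' b, w b = ∑' p : α × β, u p.1 * w p.2 := by
  rw [ENNReal.tsum_prod (f := fun a b => u a * w b)]
  simp only [ENNReal.tsum_mul_left, ENNReal.tsum_mul_right]

/-- The parallelogram law for `f + x` and `g + y` separates the exponent into terms in `f + g` and
`f - g`; these range independently once their common class modulo `2E` is fixed. -/
theorem gaussianMass_mul_gaussianMass (E : EuclideanLattice.{u}) (x y : E.space) :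
    E.gaussianMass x * E.gaussianMass y =
      ∑' c, E.classMass c (x + y) * E.classMass c (x - y) := by
  simp only [gaussianMass, classMass, tsum_mul_tsum_eq_tsum_prod]
  rw [← ENNReal.tsum_sigma, ← E.addSubEquiv.tsum_eq]
  refine tsum_congr fun p => ?_
  rw [← ENNReal.ofReal_mul (Real.exp_pos _).le, ← ENNReal.ofReal_mul (Real.exp_pos _).le,
    ← Real.exp_add, ← Real.exp_add]
  congr 2
  have h := parallelogram_law_with_norm ℝ ((p.1 : E.space) + x) (p.2 + y)
  have e1 : ((E.addSubEquiv p).2.1 : E.space) + (x + y) = p.1 + x + (p.2 + y) := by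
    change ((p.1 + p.2 : E.lattice) : E.space) + (x + y) = _
    push_cast; abel
  have e2 : ((E.addSubEquiv p).2.2 : E.space) + (x - y) = p.1 + x - (p.2 + y) := by
    change ((p.1 - p.2 : E.lattice) : E.space) + (x - y) = _
    push_cast; abel
  rw [e1, e2]
  linear_combination (Real.pi / 2) * h

theorem two_mul_mul_le_add_mul_self (a b : ℝ≥0∞) : 2 * (a * b) ≤ a * a + b * b := by
  rcases le_total a b with h | h <;> obtain ⟨c, rfl⟩ := exists_add_of_le h
  · exact le_iff_exists_add.mpr ⟨c * c, by ring⟩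
  · exact le_iff_exists_add.mpr ⟨c * c, by ring⟩

/-- Three instances of the product formula, at `(x, x)`, `(2x, 0)` and `(0, 0)`, are compared class
by class through `2ab ≤ a² + b²`. -/
theorem two_mul_gaussianMass_mul_self_le (E : EuclideanLattice.{u}) (x : E.space) :
    2 * (E.gaussianMass x * E.gaussianMass x) ≤
      E.gaussianMass (x + x) * E.gaussianMass 0 + E.gaussianMass 0 * E.gaussianMass 0 := by
  simp only [gaussianMass_mul_gaussianMass, ← ENNReal.tsum_add, ← ENNReal.tsum_mul_left,
    sub_self, add_zero, sub_zero]
  exact ENNReal.tsum_le_tsum fun c => two_mul_mul_le_add_mul_self _ _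

theorem gaussianMass_le (E : EuclideanLattice.{u}) (x : E.space) :
    E.gaussianMass x ≤ E.gaussianMass 0 := by
  obtain ⟨C, hC⟩ := E.exists_gaussianMass_le
  have hfin : ∀ y, E.gaussianMass y ≠ ⊤ := fun y => ((hC y).trans_lt ENNReal.ofReal_lt_top).ne
  let g : E.space → ℝ := fun y => (E.gaussianMass y).toReal
  have hg : ∀ y, 0 ≤ g y := fun y => ENNReal.toReal_nonneg
  have hbdd : BddAbove (Set.range g) :=
    ⟨_, Set.forall_mem_range.mpr fun y => ENNReal.toReal_mono ENNReal.ofReal_ne_top (hC y)⟩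
  have hdouble : ∀ y, 2 * g y ^ 2 ≤ g (y + y) * g 0 + g 0 ^ 2 := by
    intro y
    have h := ENNReal.toReal_mono (by simp [ENNReal.mul_ne_top, hfin]) (E.two_mul_gaussianMass_mul_self_le y)
    rw [ENNReal.toReal_add (ENNReal.mul_ne_top (hfin _) (hfin _))
      (ENNReal.mul_ne_top (hfin _) (hfin _))] at h
    simpa [ENNReal.toReal_mul, sq] using h
  set M := ⨆ y, g y
  have hM : ∀ y, g y ≤ M := le_ciSup hbdd
  -- The square root puts the bound on `g y` itself, so that it passes to the supremum.
  have hMsq : M ≤ √((M * g 0 + g 0 ^ 2) / 2) := ciSup_le fun y => Real.le_sqrt_of_sq_le (by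
    nlinarith [hdouble y, mul_le_mul_of_nonneg_right (hM (y + y)) (hg 0)])
  have hM0 : 0 ≤ M := (hg 0).trans (hM 0)
  have h1 := (Real.le_sqrt hM0 (by have := hg 0; positivity)).mp hMsq
  have h2 : M ≤ g 0 := by
    by_contra! hlt
    nlinarith [hg 0]
  exact (ENNReal.toReal_le_toReal (hfin _) (hfin _)).mp ((hM x).trans h2)

/-! ### Direct sums -/

theorem theta_directSum (E₁ : EuclideanLattice.{u}) (E₂ : EuclideanLattice.{v}) {t : ℝ}
    (ht : 0 < t) : (E₁.directSum E₂).theta t = E₁.theta t * E₂.theta t := by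
  let e : (E₁.directSum E₂).lattice ≃ E₁.lattice × E₂.lattice :=
    { toFun x := (⟨x.1.fst, x.2.1⟩, ⟨x.1.snd, x.2.2⟩)
      invFun p := ⟨WithLp.toLp 2 (p.1.1, p.2.1), p.1.2, p.2.2⟩
      left_inv _ := rfl
      right_inv _ := rfl }
  rw [theta, theta, theta, tsum_mul_tsum_of_summable_norm (E₁.summable_theta ht).norm
    (E₂.summable_theta ht).norm, ← e.tsum_eq]
  refine tsum_congr fun x => ?_
  have h : ‖(x : (E₁.directSum E₂).space)‖ ^ 2 = ‖x.1.fst‖ ^ 2 + ‖x.1.snd‖ ^ 2 :=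
    WithLp.prod_norm_sq_eq_of_L2 _
  rw [← Real.exp_add, h]
  congr 1
  change _ = -Real.pi * t * ‖x.1.fst‖ ^ 2 + -Real.pi * t * ‖x.1.snd‖ ^ 2
  ring

/-! ### Cosets and admissible exact sequences -/

/-- The coset of `F` through `e`, parametrised by the lattice vectors of `E.sub F`. -/
noncomputable def cosetEquiv (E : EuclideanLattice.{u}) (F : Submodule ℤ E.lattice)
    (e : E.lattice) : (E.sub F).lattice ≃
      {a : E.lattice // Submodule.Quotient.mk (p := F) a = Submodule.Quotient.mk e} :=
  Equiv.ofBijective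
    (fun f => ⟨⟨f.1.1, Submodule.map_subtype_le _ _ f.2⟩ + e, by
      rw [Submodule.Quotient.eq, add_sub_cancel_right]
      obtain ⟨y, hy, hyf⟩ := f.2
      exact (Subtype.ext hyf : y = ⟨f.1.1, _⟩) ▸ hy⟩) (by
    constructor
    · intro f g h
      have h1 : (f.1.1 : E.space) + e = g.1.1 + e := congrArg (fun s => (s.1 : E.space)) h
      exact Subtype.ext (Subtype.ext (add_right_cancel h1))
    · rintro ⟨a, ha⟩
      rw [Submodule.Quotient.eq] at ha
      have hmem : ((a - e : E.lattice) : E.space) ∈ F.map E.lattice.subtype :=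
        Submodule.mem_map_of_mem (f := E.lattice.subtype) ha
      exact ⟨⟨⟨_, Submodule.subset_span hmem⟩, hmem⟩,
        Subtype.ext (Subtype.ext (by simp))⟩)

theorem coe_cosetEquiv (E : EuclideanLattice.{u}) (F : Submodule ℤ E.lattice)
    (e : E.lattice) (f : (E.sub F).lattice) :
    ((E.cosetEquiv F e f : E.lattice) : E.space) =
      (E.realSpan F).subtype f.1 + (e : E.space) := rfl

theorem tsum_coset_le (E : EuclideanLattice.{u}) (F : Submodule ℤ E.lattice)
    (q : E.lattice ⧸ F) :
    ∑' a : {a : E.lattice // Submodule.Quotient.mk a = q},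
        ENNReal.ofReal (Real.exp (-Real.pi * ‖(a : E.space)‖ ^ 2)) ≤
      ENNReal.ofReal (Real.exp (-Real.pi * ‖E.quotientMap F q‖ ^ 2)) *
        (E.sub F).gaussianMass 0 := by
  obtain ⟨e, rfl⟩ := Submodule.Quotient.mk_surjective F q
  set K := E.realSpan F
  let x : K := K.orthogonalProjectionOnto e
  have hz : (e : E.space) - x ∈ Kᗮ := K.sub_starProjection_mem_orthogonal (e : E.space)
  have hq : ‖E.quotientMap F (Submodule.Quotient.mk e)‖ ≤ ‖(e : E.space) - x‖ := by
    have h : E.quotientMap F (Submodule.Quotient.mk e) =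
        Submodule.Quotient.mk ((e : E.space) - x) := by
      refine (Submodule.Quotient.eq _).mpr ?_
      change (e : E.space) - (e - x) ∈ K
      rw [sub_sub_cancel]
      exact x.2
    rw [h]
    exact Submodule.Quotient.norm_mk_le K _
  -- The maximum principle enters here: it suffices to bound by the mass of the translate by `x`,
  -- and that comparison holds term by term.
  refine le_trans ?_ (mul_le_mul_right ((E.sub F).gaussianMass_le x) _)
  rw [gaussianMass.eq_1 (E.sub F) x, ← ENNReal.tsum_mul_left, ← (E.cosetEquiv F e).tsum_eq]
  refine ENNReal.tsum_le_tsum fun f => ?_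
  let f' : K := f.1
  let y : K := f' + x
  rw [← ENNReal.ofReal_mul (Real.exp_pos _).le, ← Real.exp_add]
  refine ENNReal.ofReal_le_ofReal (Real.exp_le_exp.mpr ?_)
  have hpyth : ‖((E.cosetEquiv F e f : E.lattice) : E.space)‖ ^ 2 =
      ‖y‖ ^ 2 + ‖(e : E.space) - x‖ ^ 2 := by
    have h := norm_add_sq_eq_norm_sq_add_norm_sq_of_inner_eq_zero _ _
      ((K.mem_orthogonal _).mp hz _ y.2)
    have hs : (y : E.space) + ((e : E.space) - x) = (E.cosetEquiv F e f : E.lattice) := by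
      have hy : (y : E.space) = K.subtype f.1 + x := rfl
      rw [coe_cosetEquiv, hy]; abel
    rw [hs] at h
    simpa [sq] using h
  rw [hpyth]
  have h2 := pow_le_pow_left₀ (norm_nonneg _) hq 2
  have h3 := mul_le_mul_of_nonneg_left h2 Real.pi_pos.le
  change _ ≤ _ + -Real.pi * ‖y‖ ^ 2
  linarith

/-- Saturation makes `quotientMap` injective, so the mass of the quotient lattice is a sum over `E /
F` and can be compared with the sum over `E` fibre by fibre. -/
theorem gaussianMass_zero_le_mul (E : EuclideanLattice.{u}) (F : Submodule ℤ E.lattice)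
    (hF : E.IsSaturated F) :
    E.gaussianMass 0 ≤ (E.sub F).gaussianMass 0 * (E.quotient F hF).gaussianMass 0 := by
  have hquot : (E.quotient F hF).gaussianMass 0 =
      ∑' q : E.lattice ⧸ F,
        ENNReal.ofReal (Real.exp (-Real.pi * ‖E.quotientMap F q‖ ^ 2)) := by
    simp only [gaussianMass, add_zero]
    exact ((LinearEquiv.ofInjective _ (E.quotientMap_injective hF)).toEquiv.tsum_eq
      fun y => ENNReal.ofReal (Real.exp (-Real.pi * ‖(y : E.space ⧸ E.realSpan F)‖ ^ 2))).symm
  rw [hquot, mul_comm, ← ENNReal.tsum_mul_right, gaussianMass,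
    ← (Equiv.sigmaFiberEquiv (Submodule.Quotient.mk (p := F))).tsum_eq, ENNReal.tsum_sigma']
  simp only [add_zero]
  exact ENNReal.tsum_le_tsum fun q => E.tsum_coset_le F q

theorem theta_one_le_mul (E : EuclideanLattice.{u}) (F : Submodule ℤ E.lattice)
    (hF : E.IsSaturated F) :
    E.theta 1 ≤ (E.sub F).theta 1 * (E.quotient F hF).theta 1 := by
  have h := E.gaussianMass_zero_le_mul F hF
  have h1 := ((E.sub F).theta_pos one_pos).le
  have h2 := ((E.quotient F hF).theta_pos one_pos).le
  rwa [gaussianMass_zero, gaussianMass_zero, gaussianMass_zero, ← ENNReal.ofReal_mul h1,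
    ENNReal.ofReal_le_ofReal_iff (mul_nonneg h1 h2)] at h

end EuclideanLattice

theorem proposition4p4 :
    (∀ (E₁ : EuclideanLattice.{u}) (E₂ : EuclideanLattice.{v}),
      (E₁.directSum E₂).h0theta = E₁.h0theta + E₂.h0theta) ∧
    (∀ (E : EuclideanLattice.{u}) (F : Submodule ℤ E.lattice) (hF : E.IsSaturated F),
      E.h0theta ≤ (E.sub F).h0theta + (E.quotient F hF).h0theta) := by
  refine ⟨fun E₁ E₂ => ?_, fun E F hF => ?_⟩
  · rw [EuclideanLattice.h0theta, E₁.theta_directSum E₂ one_pos,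
      Real.log_mul (E₁.theta_pos one_pos).ne' (E₂.theta_pos one_pos).ne']
    rfl
  · refine (Real.log_le_log (E.theta_pos one_pos) (E.theta_one_le_mul F hF)).trans_eq ?_
    exact Real.log_mul ((E.sub F).theta_pos one_pos).ne' ((E.quotient F hF).theta_pos one_pos).ne'
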